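/- Let $m\ge 1$, let $\mathbb B^m\subset\mathbb C^m$ be the open unit ball, $\mathbb D=\mathbb B^1$. A Hilbert module over $\mathbb C[z]=\mathbb C[z_1,\dots,z_m]$ is a Hilbert space with a unital module action of $\mathbb C[z]$ such that every operator $M_p f=p\cdot f$ is bounded; a submodule is a closed linear subspace invariant under all $M_p$; two Hilbert modules are isometrically isomorphic if there is a unitary operator between them that intertwines the module actions. A Hilbert module $\mathcal R$ is called quasi-free over $\mathbb B^m$ of multiplicity one if it is a Hilbert space of holomorphic functions on $\mathbb B^m$ with values in a one-dimensional Hilbert space $\mathcal E$, such that point evaluations are bounded, $\mathcal R$ contains $\mathbb C[z]\otimes\mathcal E$ as a dense subspace, the module action is pointwise multiplication, and the action is bounded for the supremum norm on the ball: there is a constant $C$ with $\|p f\|\le C\,\sup_{z\in\mathbb B^m}|p(z)|\,\|f\|$ for all $p\in\mathbb C[z]$ and $f\in\mathcal R$. The Hardy space $H^2(\mathbb D)$ is the closure of the polynomials in $L^2(\partial\mathbb D)$, with the action of $\mathbb C[z]$ (in one variable) by multiplication. For $\varphi\in L^\infty(\partial\mathbb D)$ the Toeplitz operator is $T_\varphi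 f=P(\varphi f)$, with $P$ the orthogonal projection of $L^2(\partial\mathbb D)$ onto $H^2(\mathbb D)$; for a bounded holomorphic $\varphi$ on $\mathbb D$, $T_\varphi$ is formed with its radial boundary values. Theorem. Let $\mathcal R$ be a quasi-free Hilbert module over $\mathbb B^m$ of multiplicity one, and suppose that every non-zero submodule $\mathcal S$ of $\mathcal R$ is isometrically isomorphic to $\mathcal R$. Then $m=1$ and $\mathcal R$ is isometrically isomorphic, as a Hilbert module, to $H^2(\mathbb D)$. Moreover $M_z$ on $\mathcal R$ is a Toeplitz operator: there are a conformal map $\varphi$ of $\mathbb D$ onto itself and a unitary operator $V\colon\mathcal R\to H^2(\mathbb D)$ with $VM_zV^*=T_\varphi$. -/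

import Mathlib

open MeasureTheory Filter Topology
open scoped ENNReal

noncomputable section

/-! ### Hilbert modules over the polynomial ring -/

/-- A Hilbert module structure over `ℂ[z₁, …, z_m]` on the Hilbert space `H`: a unital module
action `p ↦ M_p` in which every `M_p` is a bounded operator on `H`. -/
abbrev HilbertModule (m : ℕ) (H : Type*) [NormedAddCommGroup H] [InnerProductSpace ℂ H] :=
  MvPolynomial (Fin m) ℂ →ₐ[ℂ] (H →L[ℂ] H)

namespace HilbertModule

variable {m : ℕ} {H K : Type*} [NormedAddCommGroup H] [InnerProductSpace ℂ H]
  [NormedAddCommGroup K] [InnerProductSpace ℂ K]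

/-- A closed linear subspace that is invariant under the module action. -/
structure IsSubmodule (ρ : HilbertModule m H) (S : Submodule ℂ H) : Prop where
  isClosed : IsClosed (S : Set H)
  invariant : ∀ (p : MvPolynomial (Fin m) ℂ), ∀ f ∈ S, ρ p f ∈ S

/-- The Hilbert module structure that a submodule inherits. -/
def restrict (ρ : HilbertModule m H) (S : Submodule ℂ H) (hS : ρ.IsSubmodule S) :
    HilbertModule m S :=
  AlgHom.ofLinearMap
    { toFun := fun p => (ρ p).restrict (hS.invariant p)
      map_add' := fun p q => by ext f; simp
      map_smul' := fun c p => by ext f; simp }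
    (by ext f; simp)
    (fun p q => by ext f; simp)

/-- Isometric isomorphism (unitary equivalence) of Hilbert modules: there is a unitary module
map between them. -/
def IsometricallyIsomorphic (ρ : HilbertModule m H) (σ : HilbertModule m K) : Prop :=
  ∃ U : H ≃ₗᵢ[ℂ] K, ∀ (p : MvPolynomial (Fin m) ℂ) (f : H), U (ρ p f) = σ p (U f)

/-- The Hilbert module `R` over the unit ball of `ℂ^m` is quasi-free, with coefficient space `E`.
The instance `RKHS` says that `R` is a Hilbert space of `E`-valued functions on the ball with
bounded point evaluations. -/
structure IsQuasiFree {R E : Type*} [NormedAddCommGroup R] [InnerProductSpace ℂ R]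
    [NormedAddCommGroup E] [InnerProductSpace ℂ E]
    [RKHS ℂ R (Metric.ball (0 : EuclideanSpace ℂ (Fin m)) 1) E] (ρ : HilbertModule m R) :
    Prop where
  /-- Every element of `R` is a holomorphic function on the ball. -/
  holomorphic : ∀ f : R, ∃ F : EuclideanSpace ℂ (Fin m) → E,
    DifferentiableOn ℂ F (Metric.ball 0 1) ∧
      ∀ z : Metric.ball (0 : EuclideanSpace ℂ (Fin m)) 1, F z = f z
  /-- `R` contains the algebraic tensor product `ℂ[z] ⊗ E`. -/
  polynomial_mem : ∀ (p : MvPolynomial (Fin m) ℂ) (x : E), ∃ f : R, ∀ z,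
    f z = MvPolynomial.eval (fun i => (z : EuclideanSpace ℂ (Fin m)) i) p • x
  /-- `ℂ[z] ⊗ E` is dense in `R`. -/
  polynomial_dense : (Submodule.span ℂ {f : R | ∃ (p : MvPolynomial (Fin m) ℂ) (x : E), ∀ z,
    f z = MvPolynomial.eval (fun i => (z : EuclideanSpace ℂ (Fin m)) i) p • x}).topologicalClosure
      = ⊤
  /-- The module action is pointwise multiplication. -/
  action : ∀ (p : MvPolynomial (Fin m) ℂ) (f : R) (z), (ρ p f) z =
    MvPolynomial.eval (fun i => (z : EuclideanSpace ℂ (Fin m)) i) p • f z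
  /-- The action is bounded for the supremum norm of polynomials over the ball, that is, `R` is a
  module over the ball algebra. -/
  bounded : ∃ C : ℝ, ∀ (p : MvPolynomial (Fin m) ℂ) (M : ℝ),
    (∀ z ∈ Metric.ball (0 : EuclideanSpace ℂ (Fin m)) 1,
      ‖MvPolynomial.eval (fun i => z i) p‖ ≤ M) → ‖ρ p‖ ≤ C * M

end HilbertModule

/-! ### The Hardy space of the disk and Toeplitz operators

The unit circle is parametrized by `t ∈ ℝ/ℤ`, through `ζ = AddCircle.toCircle t = exp (2πit)`, and
carries the normalized Lebesgue measure. -/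

/-- `L²` of the unit circle. -/
abbrev CircleL2 := Lp ℂ 2 (AddCircle.haarAddCircle (T := 1))

/-- `L^∞` of the unit circle. -/
abbrev CircleLinfty := Lp ℂ ∞ (AddCircle.haarAddCircle (T := 1))

/-- The Hardy space `H²(𝔻)`: the closure in `L²` of the unit circle of the polynomials in
`ζ`. (`fourierLp 2 n` is the class of `ζ ^ n`.) -/
def hardy : Submodule ℂ CircleL2 :=
  (Submodule.span ℂ (Set.range fun n : ℕ => fourierLp (T := 1) 2 (n : ℤ))).topologicalClosure

instance hardy.instCompleteSpace : CompleteSpace hardy :=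
  (Submodule.isClosed_topologicalClosure _).completeSpace_coe

/-- Multiplication by a bounded function, on `L²` of the unit circle. -/
def circleMul (g : CircleLinfty) : CircleL2 →L[ℂ] CircleL2 :=
  (ContinuousLinearMap.mul ℂ ℂ).holderL (AddCircle.haarAddCircle (T := 1)) ∞ 2 2 g

/-- The Toeplitz operator `T_g f = P (g f)` on `H²(𝔻)`, where `P` is the orthogonal projection of
`L²` onto `H²(𝔻)`. -/
def toeplitz (g : CircleLinfty) : hardy →L[ℂ] hardy :=
  hardy.orthogonalProjectionOnto ∘L circleMul g ∘L hardy.subtypeL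

theorem circleMul_fourierLp (n : ℕ) :
    circleMul (fourierLp ∞ 1) (fourierLp 2 (n : ℤ)) = fourierLp 2 ((n + 1 : ℕ) : ℤ) := by
  apply Lp.ext
  refine (ContinuousLinearMap.coeFn_holder (r := 2) (ContinuousLinearMap.mul ℂ ℂ)
    (fourierLp (T := 1) ∞ 1) (fourierLp 2 (n : ℤ))).trans ?_
  filter_upwards [coeFn_fourierLp (T := 1) ∞ 1, coeFn_fourierLp (T := 1) 2 (n : ℤ),
    coeFn_fourierLp (T := 1) 2 ((n + 1 : ℕ) : ℤ)] with t h1 h2 h3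
  rw [h1, h2, h3, ContinuousLinearMap.mul_apply', ← fourier_add]
  push_cast
  rw [add_comm]

theorem circleMul_mem_hardy (f : CircleL2) (hf : f ∈ hardy) :
    circleMul (fourierLp ∞ 1) f ∈ hardy := by
  have h : Set.MapsTo (circleMul (fourierLp ∞ 1))
      (Submodule.span ℂ (Set.range fun n : ℕ => fourierLp (T := 1) 2 (n : ℤ)) : Set CircleL2)
      (Submodule.span ℂ (Set.range fun n : ℕ => fourierLp (T := 1) 2 (n : ℤ)) : Set CircleL2) := by
    intro g hg
    have : Submodule.span ℂ (Set.range fun n : ℕ => fourierLp (T := 1) 2 (n : ℤ)) ≤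
        (Submodule.span ℂ (Set.range fun n : ℕ => fourierLp (T := 1) 2 (n : ℤ))).comap
          (circleMul (fourierLp ∞ 1)).toLinearMap := by
      rw [Submodule.span_le]
      rintro _ ⟨n, rfl⟩
      exact Submodule.subset_span ⟨n + 1, (circleMul_fourierLp n).symm⟩
    exact this hg
  exact h.closure (circleMul (fourierLp ∞ 1)).continuous hf

/-- Multiplication by the coordinate function on `H²(𝔻)`. -/
def hardyShift : hardy →L[ℂ] hardy :=
  (circleMul (fourierLp ∞ 1)).restrict circleMul_mem_hardy

/-- `H²(𝔻)` as a Hilbert module over `ℂ[z]`: a polynomial acts by multiplication. -/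
def hardyModule : HilbertModule 1 hardy :=
  (Polynomial.aeval hardyShift).comp
    (MvPolynomial.aeval fun _ : Fin 1 => (Polynomial.X : Polynomial ℂ))

/-- `φ` restricts to a conformal map of the open unit disk onto itself. -/
def IsConformalSelfMap (φ : ℂ → ℂ) : Prop :=
  DifferentiableOn ℂ φ (Metric.ball 0 1) ∧
    Set.BijOn φ (Metric.ball 0 1) (Metric.ball 0 1)

/-- `g` is the radial boundary function, on the unit circle, of the function `φ` on the disk. -/
def IsBoundaryFunction (φ : ℂ → ℂ) (g : CircleLinfty) : Prop :=
  ∀ᵐ t ∂(AddCircle.haarAddCircle (T := 1)),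
    Tendsto (fun r : ℝ => φ (r * (AddCircle.toCircle t : ℂ))) (𝓝[<] 1) (𝓝 (g t))

end

/-! The submodule of functions vanishing at the origin already decides everything. Since `1` is
cyclic, a unitary module map from `R` onto it is multiplication by one function `φ`
(`exists_isometric_multiplier`), so every coordinate factors as `z i = φ * g`. Differentiating at
`0`, where `φ` vanishes, makes all coordinate functionals multiples of `dφ(0)`; hence `m = 1`. In
one variable, `φ ^ n` has the norm of `1`, which forces `|φ| ≤ 1`. Dividing repeatedly, `z ^ n = φ ^
n * g` with `‖g‖ = ‖z ^ n‖` bounded in `n`, which forces `|z| ≤ |φ z|`. Equality in the Schwarz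
lemma gives `φ = c z` with `|c| = 1` (`isometric_multiplier_eq_smul_coordinate`). So `M_z` is an
isometry whose range is the kernel of evaluation at `0`, of codimension one. The Wold argument makes
it a unilateral shift (`exists_hilbertBasis_of_isometric_mul`), unitarily equivalent to the shift on
the Hardy space. -/

/-- Taking `n`-th roots removes the constant; this turns norm bounds on powers into pointwise
bounds. -/
theorem le_of_forall_pow_le_mul_pow {a b M : ℝ} (hb : 0 ≤ b)
    (h : ∀ n : ℕ, a ^ n ≤ M * b ^ n) : a ≤ b := by
  by_contra! hab
  rcases hb.eq_or_lt with rfl | hb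
  · have := h 1
    simp only [pow_one, mul_zero] at this
    linarith
  · obtain ⟨n, hn⟩ := pow_unbounded_of_one_lt M ((one_lt_div hb).2 hab)
    rw [div_pow, lt_div_iff₀ (by positivity)] at hn
    exact absurd (h n) hn.not_ge

/-! ### Shifts and the Hardy space -/

namespace HilbertBasis

variable {H K : Type*} [NormedAddCommGroup H] [InnerProductSpace ℂ H]
  [NormedAddCommGroup K] [InnerProductSpace ℂ K]

/-- Operators that shift Hilbert bases are unitarily equivalent. -/
theorem exists_unitary_intertwining_of_shift (b : HilbertBasis ℕ ℂ H) (c : HilbertBasis ℕ ℂ K)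
    (S : H →L[ℂ] H) (T : K →L[ℂ] K) (hS : ∀ n, S (b n) = b (n + 1))
    (hT : ∀ n, T (c n) = c (n + 1)) :
    ∃ U : H ≃ₗᵢ[ℂ] K, ∀ f, U (S f) = T (U f) := by
  let U : H ≃ₗᵢ[ℂ] K := b.repr.trans c.repr.symm
  have hU : ∀ n, U (b n) = c n := fun n => by
    classical
    rw [LinearIsometryEquiv.trans_apply, b.repr_self, c.repr_symm_single]
  have h : (U.toContinuousLinearEquiv : H →L[ℂ] K) ∘L S =
      T ∘L (U.toContinuousLinearEquiv : H →L[ℂ] K) := by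
    refine ContinuousLinearMap.ext_on
      ((Submodule.dense_iff_topologicalClosure_eq_top).2 b.dense_span) ?_
    rintro _ ⟨n, rfl⟩
    simp [hS, hT, hU]
  exact ⟨U, fun f => congrArg (fun A : H →L[ℂ] K => A f) h⟩

end HilbertBasis

theorem fourierLp_mem_hardy (n : ℕ) : fourierLp (T := 1) 2 (n : ℤ) ∈ hardy :=
  Submodule.le_topologicalClosure _ (Submodule.subset_span ⟨n, rfl⟩)

/-- The monomials form a Hilbert basis of the Hardy space. -/
theorem exists_hilbertBasis_hardy :
    ∃ b : HilbertBasis ℕ ℂ hardy, ∀ n : ℕ, (b n : CircleL2) = fourierLp 2 (n : ℤ) := by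
  let v : ℕ → hardy := fun n => ⟨fourierLp 2 (n : ℤ), fourierLp_mem_hardy n⟩
  have hv : Orthonormal ℂ v := by
    have h := (orthonormal_fourier (T := 1)).comp (fun n : ℕ => (n : ℤ)) Nat.cast_injective
    rw [orthonormal_iff_ite] at h ⊢
    exact h
  have hbot : (Submodule.span ℂ (Set.range v))ᗮ = ⊥ := by
    rw [Submodule.eq_bot_iff]
    intro f hf
    have h1 : (f : CircleL2) ∈
        (Submodule.span ℂ (Set.range fun n : ℕ => fourierLp (T := 1) 2 (n : ℤ)))ᗮ := by
      rw [Submodule.mem_orthogonal]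
      intro u hu
      induction hu using Submodule.span_induction with
      | mem x hx =>
        obtain ⟨n, rfl⟩ := hx
        exact (Submodule.mem_orthogonal _ _).1 hf (v n) (Submodule.subset_span ⟨n, rfl⟩)
      | zero => simp
      | add x y _ _ hx hy => rw [inner_add_left, hx, hy, add_zero]
      | smul a x _ hx => rw [inner_smul_left, hx, mul_zero]
    -- Now `f` lies both in the closed span and in its orthogonal complement.
    rw [← Submodule.orthogonal_closure] at h1
    have h2 := (Submodule.mem_orthogonal _ _).1 h1 f f.2
    exact Subtype.ext (inner_self_eq_zero.1 h2)
  refine ⟨HilbertBasis.mkOfOrthogonalEqBot hv hbot, fun n => ?_⟩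
  rw [HilbertBasis.coe_mkOfOrthogonalEqBot]

/-- Multiplication by `ζ` preserves the Hardy space, so the projection does nothing. -/
theorem toeplitz_fourierLp_one : toeplitz (fourierLp ∞ 1) = hardyShift := by
  ext1 f
  exact Submodule.orthogonalProjectionOnto_mem_subspace_eq_self (hardyShift f)

theorem hardyModule_X : hardyModule (MvPolynomial.X 0) = hardyShift := by
  simp [hardyModule]

/-! ### Isometric multipliers on the disk -/

/-- A multiplication operator by the coordinate function that is isometric, with range the
functions vanishing at a point, is a unilateral shift. -/
theorem exists_hilbertBasis_of_isometric_mul {R : Type*} [NormedAddCommGroup R]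
    [InnerProductSpace ℂ R] [CompleteSpace R] (ev : ℂ → R →L[ℂ] ℂ)
    (hinj : ∀ f, (∀ z ∈ Metric.ball (0 : ℂ) 1, ev z f = 0) → f = 0)
    (hne : ev 0 ≠ 0) (T : R →L[ℂ] R)
    (hT : ∀ z ∈ Metric.ball (0 : ℂ) 1, ∀ f, ev z (T f) = z * ev z f)
    (hiso : ∀ f, ‖T f‖ = ‖f‖) (hker : ∀ f, ev 0 f = 0 → ∃ g, T g = f) :
    ∃ b : HilbertBasis ℕ ℂ R, ∀ n, T (b n) = b (n + 1) := by
  have hTn : ∀ (n : ℕ) f, ‖(T ^ n) f‖ = ‖f‖ := by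
    intro n
    induction n with
    | zero => simp
    | succ n ih => intro f; rw [pow_succ', mul_apply_eq_comp, hiso, ih]
  have hin : ∀ f g, inner ℂ (T f) (T g) = inner ℂ f g :=
    LinearIsometry.inner_map_map ⟨T.toLinearMap, hiso⟩
  have hinn : ∀ (n : ℕ) f g, inner ℂ ((T ^ n) f) ((T ^ n) g) = inner ℂ f g := fun n =>
    LinearIsometry.inner_map_map ⟨(T ^ n).toLinearMap, hTn n⟩
  -- The reproducing kernel at `0` spans the complement of the range of `T`, the wandering subspace.
  set k : R := (InnerProductSpace.toDual ℂ R).symm (ev 0) with hk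
  have hkev : ∀ f, inner ℂ k f = ev 0 f := fun f => by simp [hk]
  have hk0 : k ≠ 0 := by simpa [hk] using hne
  set e : R := ((‖k‖ : ℂ)⁻¹) • k with he
  have hee : ‖e‖ = 1 := by
    rw [he, norm_smul, norm_inv, Complex.norm_real, norm_norm, inv_mul_cancel₀ (by simpa)]
  have heT : ∀ f, inner ℂ e (T f) = 0 := fun f => by
    rw [he, inner_smul_left, hkev, hT 0 (by simp), zero_mul, mul_zero]
  have hlt : ∀ i j : ℕ, i < j → inner ℂ ((T ^ i) e) ((T ^ j) e) = 0 := by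
    intro i j hij
    obtain ⟨d, rfl⟩ := Nat.exists_eq_add_of_lt hij
    rw [add_assoc, pow_add, mul_apply_eq_comp, hinn, pow_succ',
      mul_apply_eq_comp, heT]
  have hv : Orthonormal ℂ fun n : ℕ => (T ^ n) e := by
    refine ⟨fun n => by rw [hTn, hee], fun i j hij => ?_⟩
    rcases hij.lt_or_gt with h | h
    · exact hlt i j h
    · exact inner_eq_zero_symm.1 (hlt j i h)
  -- Orthogonality to `e` says that `f` vanishes at `0`, so `f = T g`; as `T` is isometric, `g`
  -- inherits the orthogonality relations.
  have hdiv : ∀ (n : ℕ) f, (∀ i, inner ℂ ((T ^ i) e) f = 0) → ∃ g, (T ^ n) g = f := by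
    intro n
    induction n with
    | zero => intro f _; exact ⟨f, by simp⟩
    | succ n ih =>
      intro f hf
      obtain ⟨g, rfl⟩ := hker f (by
        have h := hf 0
        rw [pow_zero, one_apply_eq_self, he, inner_smul_left, hkev] at h
        exact (mul_eq_zero.1 h).resolve_left (by simpa using hk0))
      obtain ⟨h, rfl⟩ := ih g fun i => by
        rw [← hin, ← mul_apply_eq_comp, ← pow_succ']
        exact hf (i + 1)
      exact ⟨h, by rw [pow_succ', mul_apply_eq_comp]⟩
  have hpow : ∀ z ∈ Metric.ball (0 : ℂ) 1, ∀ (n : ℕ) f, ev z ((T ^ n) f) = z ^ n * ev z f := by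
    intro z hz n
    induction n with
    | zero => simp
    | succ n ih =>
      intro f
      rw [pow_succ', mul_apply_eq_comp, hT z hz, ih, pow_succ', mul_assoc]
  have hbot : (Submodule.span ℂ (Set.range fun n : ℕ => (T ^ n) e))ᗮ = ⊥ := by
    rw [Submodule.eq_bot_iff]
    intro f hf
    refine hinj f fun z hz => ?_
    have hf' : ∀ i, inner ℂ ((T ^ i) e) f = 0 := fun i =>
      (Submodule.mem_orthogonal _ _).1 hf _ (Submodule.subset_span ⟨i, rfl⟩)
    -- Here `f = z ^ n * g` with `‖g‖ = ‖f‖`, so letting `n` grow kills `f` pointwise.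
    have hle : ∀ n : ℕ, ‖ev z f‖ ≤ ‖z‖ ^ n * (‖ev z‖ * ‖f‖) := by
      intro n
      obtain ⟨g, rfl⟩ := hdiv n f hf'
      rw [hpow z hz, norm_mul, norm_pow, hTn]
      gcongr
      exact (ev z).le_opNorm g
    have hlim : Tendsto (fun n : ℕ => ‖z‖ ^ n * (‖ev z‖ * ‖f‖)) atTop (𝓝 0) := by
      have := (tendsto_pow_atTop_nhds_zero_of_lt_one (norm_nonneg z)
        (by simpa using hz)).mul_const (‖ev z‖ * ‖f‖)
      rwa [zero_mul] at this
    exact norm_le_zero_iff.1 (ge_of_tendsto' hlim hle)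
  refine ⟨HilbertBasis.mkOfOrthogonalEqBot hv hbot, fun n => ?_⟩
  rw [HilbertBasis.coe_mkOfOrthogonalEqBot, pow_succ', mul_apply_eq_comp]

/-- On a Hilbert space of holomorphic functions on the disk on which the coordinate function
acts power-boundedly, an isometric multiplier whose range consists of the functions vanishing at
the origin is a unimodular multiple of the coordinate function. -/
theorem isometric_multiplier_eq_smul_coordinate {R : Type*} [NormedAddCommGroup R]
    [InnerProductSpace ℂ R] (ev : ℂ → R →L[ℂ] ℂ)
    (hinj : ∀ f, (∀ z ∈ Metric.ball (0 : ℂ) 1, ev z f = 0) → f = 0)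
    (hhol : ∀ f, DifferentiableOn ℂ (fun z => ev z f) (Metric.ball 0 1))
    (one : R) (hone : ∀ z ∈ Metric.ball (0 : ℂ) 1, ev z one = 1) (T : R →L[ℂ] R)
    (hT : ∀ z ∈ Metric.ball (0 : ℂ) 1, ∀ f, ev z (T f) = z * ev z f)
    (C : ℝ) (hC : ∀ n : ℕ, ‖T ^ n‖ ≤ C) (W : R →ₗᵢ[ℂ] R)
    (hW : ∀ z ∈ Metric.ball (0 : ℂ) 1, ∀ f, ev z (W f) = ev z (W one) * ev z f)
    (hker : ∀ f, ev 0 f = 0 ↔ ∃ g, W g = f) :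
    ∃ c : ℂ, ‖c‖ = 1 ∧ ∀ f, W f = c • T f := by
  set φ : ℂ → ℂ := fun z => ev z (W one)
  have hWn : ∀ z ∈ Metric.ball (0 : ℂ) 1, ∀ (n : ℕ) f,
      ev z (W^[n] f) = φ z ^ n * ev z f := by
    intro z hz n
    induction n with
    | zero => simp
    | succ n ih =>
      intro f
      rw [Function.iterate_succ_apply', hW z hz, ih, pow_succ', mul_assoc]
  have hWnorm : ∀ (n : ℕ) f, ‖W^[n] f‖ = ‖f‖ := by
    intro n
    induction n with
    | zero => simp
    | succ n ih => intro f; rw [Function.iterate_succ_apply', W.norm_map, ih]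
  have hle1 : ∀ z ∈ Metric.ball (0 : ℂ) 1, ‖φ z‖ ≤ 1 := by
    intro z hz
    refine le_of_forall_pow_le_mul_pow zero_le_one (M := ‖ev z‖ * ‖one‖) fun n => ?_
    have h := (ev z).le_opNorm (W^[n] one)
    rw [hWn z hz, hone z hz, mul_one, norm_pow, hWnorm] at h
    simpa using h
  have hφ0 : φ 0 = 0 := (hker _).2 ⟨one, rfl⟩
  have hmaps : Set.MapsTo φ (Metric.ball 0 1) (Metric.closedBall (φ 0) 1) := fun z hz => by
    rw [hφ0]; simpa using hle1 z hz
  have hcomm : ∀ (n : ℕ) f, T (W^[n] f) = W^[n] (T f) := by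
    intro n f
    rw [← sub_eq_zero]
    refine hinj _ fun z hz => ?_
    rw [map_sub, hT z hz, hWn z hz, hWn z hz, hT z hz]
    ring
  -- If `z ^ n = φ ^ n * g`, then `z * g` vanishes at `0`, hence is `φ * g'`.
  have hdiv : ∀ n : ℕ, ∃ g, W^[n] g = (T ^ n) one := by
    intro n
    induction n with
    | zero => exact ⟨one, by simp⟩
    | succ n ih =>
      obtain ⟨g, hg⟩ := ih
      obtain ⟨g', hg'⟩ := (hker (T g)).1 (by rw [hT 0 (by simp), zero_mul])
      exact ⟨g', by rw [Function.iterate_succ_apply, hg', ← hcomm, hg, pow_succ',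
        mul_apply_eq_comp]⟩
  have hTn : ∀ z ∈ Metric.ball (0 : ℂ) 1, ∀ n : ℕ, ev z ((T ^ n) one) = z ^ n := by
    intro z hz n
    induction n with
    | zero => simpa using hone z hz
    | succ n ih => rw [pow_succ', mul_apply_eq_comp, hT z hz, ih, pow_succ']
  have hge : ∀ z ∈ Metric.ball (0 : ℂ) 1, ‖z‖ ≤ ‖φ z‖ := by
    intro z hz
    refine le_of_forall_pow_le_mul_pow (norm_nonneg _) (M := ‖ev z‖ * (C * ‖one‖)) fun n => ?_
    obtain ⟨g, hg⟩ := hdiv n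
    have h1 : ‖g‖ ≤ C * ‖one‖ := by
      rw [← hWnorm n g, hg]
      exact ((T ^ n).le_opNorm one).trans (by gcongr; exact hC n)
    rw [← norm_pow, ← hTn z hz, ← hg, hWn z hz, norm_mul, norm_pow, mul_comm]
    gcongr
    exact ((ev z).le_opNorm g).trans (by gcongr)
  -- Equality in the Schwarz lemma is needed at one nonzero point only; `1 / 2` is an arbitrary
  -- choice.
  have hhalf : (1 / 2 : ℂ) ∈ Metric.ball (0 : ℂ) 1 := by norm_num
  have hslope : ‖dslope φ 0 (1 / 2)‖ = 1 := by
    refine le_antisymm ?_ ?_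
    · simpa using Complex.norm_dslope_le_div_of_mapsTo_ball (hhol _) hmaps hhalf
    · have := hge _ hhalf
      rw [dslope_of_ne _ (by norm_num), slope_def_field, hφ0, sub_zero, sub_zero, norm_div]
      rwa [le_div_iff₀ (by norm_num), one_mul]
  have haff := Complex.affine_of_mapsTo_ball_of_norm_dslope_eq_div (hhol (W one))
    hmaps hhalf (by simpa using hslope)
  refine ⟨dslope φ 0 (1 / 2), hslope, fun f => ?_⟩
  rw [← sub_eq_zero]
  refine hinj _ fun z hz => ?_
  have h := haff hz
  simp only [sub_zero, smul_eq_mul] at h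
  rw [map_sub, map_smul, hW z hz, hT z hz, h, smul_eq_mul]
  change (φ 0 + z * _) * _ - _ = 0
  rw [hφ0]
  ring

/-! ### Quasi-free modules and the vanishing submodule -/

namespace HilbertModule

variable {m : ℕ} {R E : Type*} [NormedAddCommGroup R] [InnerProductSpace ℂ R]
  [NormedAddCommGroup E] [InnerProductSpace ℂ E]

/-- Scalar point evaluations on a quasi-free Hilbert module of multiplicity one. -/
theorem IsQuasiFree.exists_scalar_eval
    [RKHS ℂ R (Metric.ball (0 : EuclideanSpace ℂ (Fin m)) 1) E] {ρ : HilbertModule m R}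
    (hρ : ρ.IsQuasiFree) (hE : Module.finrank ℂ E = 1) :
    ∃ (ev : EuclideanSpace ℂ (Fin m) → R →L[ℂ] ℂ) (one : R),
      (∀ f, (∀ z ∈ Metric.ball 0 1, ev z f = 0) → f = 0) ∧
      (∀ f, DifferentiableOn ℂ (fun z => ev z f) (Metric.ball 0 1)) ∧
      (∀ z ∈ Metric.ball 0 1, ev z one = 1) ∧
      (∀ z ∈ Metric.ball 0 1, ∀ p f, ev z (ρ p f) = MvPolynomial.eval (fun i => z i) p * ev z f) ∧
      DenseRange fun p => ρ p one := by
  classical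
  obtain ⟨x, hx, hxs⟩ := finrank_eq_one_iff'.1 hE
  -- The coordinate along `x`, which need not be a unit vector.
  let L : E →L[ℂ] ℂ := ((‖x‖ : ℂ) ^ 2)⁻¹ • innerSL ℂ x
  have hx' : (‖x‖ : ℂ) ^ 2 ≠ 0 := by simpa using hx
  have hL : ∀ c : ℂ, L (c • x) = c := fun c => by
    simp only [L, smul_apply, map_smul, innerSL_apply_apply,
      inner_self_eq_norm_sq_to_K, smul_eq_mul]
    exact (congrArg (c * ·) (inv_mul_cancel₀ hx')).trans (mul_one c)
  have hLx : ∀ w, L w • x = w := fun w => by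
    obtain ⟨c, rfl⟩ := hxs w
    rw [hL]
  obtain ⟨one, hone⟩ := hρ.polynomial_mem 1 x
  have hone' : ∀ z, one z = x := fun z => by simpa using hone z
  let ev : EuclideanSpace ℂ (Fin m) → R →L[ℂ] ℂ := fun z =>
    if hz : z ∈ Metric.ball 0 1 then
      L ∘L (ContinuousLinearMap.proj (⟨z, hz⟩ : Metric.ball (0 : EuclideanSpace ℂ (Fin m)) 1)) ∘L
        RKHS.coeCLM ℂ
    else 0
  have hev : ∀ z (hz : z ∈ Metric.ball 0 1) f, ev z f = L (f ⟨z, hz⟩) := fun z hz f => by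
    simp only [ev, dif_pos hz]
    rfl
  refine ⟨ev, one, fun f hf => ?_, fun f => ?_, fun z hz => ?_, fun z hz p f => ?_, ?_⟩
  · ext z
    rw [← hLx (f z), ← hev z z.2, hf z z.2, zero_smul, RKHS.coe_zero, Pi.zero_apply]
  · obtain ⟨F, hF, hFf⟩ := hρ.holomorphic f
    refine (L.differentiable.comp_differentiableOn hF).congr fun z hz => ?_
    rw [hev z hz, ← hFf]
    rfl
  · rw [hev z hz, hone']
    simpa using hL 1
  · rw [hev z hz, hev z hz, hρ.action, map_smul, smul_eq_mul]
  · let A : MvPolynomial (Fin m) ℂ →ₗ[ℂ] R :=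
      (ContinuousLinearMap.apply ℂ R one).toLinearMap ∘ₗ ρ.toLinearMap
    have hA : ∀ p, A p = ρ p one := fun p => rfl
    have hle : Submodule.span ℂ {f : R | ∃ (p : MvPolynomial (Fin m) ℂ) (x : E), ∀ z,
        f z = MvPolynomial.eval (fun i => (z : EuclideanSpace ℂ (Fin m)) i) p • x} ≤
        LinearMap.range A := by
      rw [Submodule.span_le]
      rintro f ⟨p, y, hf⟩
      obtain ⟨c, rfl⟩ := hxs y
      refine ⟨c • p, ?_⟩
      rw [hA]
      ext z
      rw [hρ.action, hone', hf, MvPolynomial.smul_eval, smul_smul, mul_comm]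
    have h := Submodule.topologicalClosure_mono hle
    rw [hρ.polynomial_dense, top_le_iff, ← Submodule.dense_iff_topologicalClosure_eq_top] at h
    exact h

/-- If the submodule of functions vanishing at the origin is isometrically isomorphic to the whole
module, then it is the range of an isometric multiplier. -/
theorem exists_isometric_multiplier {ρ : HilbertModule m R} (hm : 1 ≤ m)
    (ev : EuclideanSpace ℂ (Fin m) → R →L[ℂ] ℂ) (one : R)
    (hone : ∀ z ∈ Metric.ball 0 1, ev z one = 1)
    (hact : ∀ z ∈ Metric.ball 0 1, ∀ p f,
      ev z (ρ p f) = MvPolynomial.eval (fun i => z i) p * ev z f)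
    (hdense : DenseRange fun p => ρ p one)
    (hsub : ∀ (S : Submodule ℂ R) (hS : ρ.IsSubmodule S), S ≠ ⊥ →
      (ρ.restrict S hS).IsometricallyIsomorphic ρ) :
    ∃ W : R →ₗᵢ[ℂ] R,
      (∀ z ∈ Metric.ball 0 1, ∀ f, ev z (W f) = ev z (W one) * ev z f) ∧
      ∀ f, ev 0 f = 0 ↔ ∃ g, W g = f := by
  have hS : ρ.IsSubmodule (LinearMap.ker (ev 0).toLinearMap) :=
    ⟨(ev 0).isClosed_ker, fun p f hf => by
      have hf : ev 0 f = 0 := hf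
      change ev 0 (ρ p f) = 0
      rw [hact 0 (by simp), hf, mul_zero]⟩
  have hne : LinearMap.ker (ev 0).toLinearMap ≠ ⊥ := by
    intro h
    have h1 : ρ (MvPolynomial.X ⟨0, hm⟩) one ∈ LinearMap.ker (ev 0).toLinearMap := by
      change ev 0 _ = 0
      rw [hact 0 (by simp)]
      simp
    rw [h, Submodule.mem_bot] at h1
    -- A point of the ball where the first coordinate function is nonzero.
    have hz : EuclideanSpace.single (⟨0, hm⟩ : Fin m) (1 / 2 : ℂ) ∈ Metric.ball 0 1 := by
      rw [mem_ball_zero_iff, PiLp.norm_single]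
      norm_num
    have h2 := hact _ hz (MvPolynomial.X ⟨0, hm⟩) one
    rw [h1, hone _ hz] at h2
    simp at h2
  obtain ⟨U, hU⟩ := hsub _ hS hne
  let W : R →ₗᵢ[ℂ] R := (Submodule.subtypeₗᵢ _).comp U.symm.toLinearIsometry
  have hWρ : ∀ p f, W (ρ p f) = ρ p (W f) := by
    intro p f
    have h := hU p (U.symm f)
    rw [U.apply_symm_apply, ← U.eq_symm_apply] at h
    exact (congrArg Subtype.val h).symm
  refine ⟨W, fun z hz f => ?_, fun f => ⟨fun hf => ⟨U ⟨f, hf⟩, ?_⟩, ?_⟩⟩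
  -- Both sides are continuous and agree on the dense orbit of `one`.
  · have h : (ev z) ∘L W.toContinuousLinearMap = ev z (W one) • ev z := by
      refine DFunLike.coe_injective (hdense.equalizer (by fun_prop) (by fun_prop) ?_)
      ext p
      simp only [Function.comp_apply, ContinuousLinearMap.comp_apply,
        LinearIsometry.coe_toContinuousLinearMap, smul_apply, smul_eq_mul]
      rw [hWρ, hact z hz, hact z hz, hone z hz]
      ring
    exact congrArg (fun A : R →L[ℂ] ℂ => A f) h
  · change ((U.symm (U ⟨f, hf⟩) : LinearMap.ker (ev 0).toLinearMap) : R) = f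
    rw [U.symm_apply_apply]
  · rintro ⟨g, rfl⟩
    exact (U.symm g).2

/-- Two coordinate functions have no common factor that vanishes at the origin. -/
theorem dimension_le_one_of_forall_coordinate_eq_mul {φ : EuclideanSpace ℂ (Fin m) → ℂ}
    (hφ : DifferentiableAt ℂ φ 0) (hφ0 : φ 0 = 0)
    (h : ∀ i, ∃ g : EuclideanSpace ℂ (Fin m) → ℂ, DifferentiableAt ℂ g 0 ∧
      ∀ᶠ z in 𝓝 0, z i = φ z * g z) : m ≤ 1 := by
  by_contra! hm
  have key : ∀ i, ∃ a : ℂ, ∀ v : EuclideanSpace ℂ (Fin m), v i = a * fderiv ℂ φ 0 v := by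
    intro i
    obtain ⟨g, hg, hgi⟩ := h i
    -- In the product rule the term with `φ 0` drops out, leaving `g 0 • dφ(0)`.
    have h1 := (hφ.hasFDerivAt.mul hg.hasFDerivAt).congr_of_eventuallyEq hgi
    have h2 := h1.unique (EuclideanSpace.proj i : EuclideanSpace ℂ (Fin m) →L[ℂ] ℂ).hasFDerivAt
    refine ⟨g 0, fun v => ?_⟩
    have h3 := congrArg (fun A : EuclideanSpace ℂ (Fin m) →L[ℂ] ℂ => A v) h2
    simpa [hφ0] using h3.symm
  obtain ⟨a, ha⟩ := key ⟨0, by omega⟩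
  obtain ⟨b, hb⟩ := key ⟨1, hm⟩
  have h1 := ha (EuclideanSpace.single ⟨0, by omega⟩ 1)
  have h2 := ha (EuclideanSpace.single ⟨1, hm⟩ 1)
  have h3 := hb (EuclideanSpace.single ⟨1, hm⟩ 1)
  simp only [PiLp.single_apply, Fin.mk.injEq, if_true, zero_ne_one, if_false] at h1 h2 h3
  rcases mul_eq_zero.1 h2.symm with h | h
  · rw [h, zero_mul] at h1
    exact one_ne_zero h1
  · rw [h, mul_zero] at h3
    exact one_ne_zero h3

/-- A unitary operator that intertwines the actions of the coordinate function intertwines the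
module actions. -/
theorem intertwines_of_intertwines_X {H K : Type*} [NormedAddCommGroup H] [InnerProductSpace ℂ H]
    [NormedAddCommGroup K] [InnerProductSpace ℂ K] (ρ : HilbertModule 1 H) (σ : HilbertModule 1 K)
    (U : H ≃ₗᵢ[ℂ] K)
    (hU : ∀ f, U (ρ (MvPolynomial.X 0) f) = σ (MvPolynomial.X 0) (U f))
    (p : MvPolynomial (Fin 1) ℂ) (f : H) : U (ρ p f) = σ p (U f) := by
  induction p using MvPolynomial.induction_on generalizing f with
  | C a => simp [← MvPolynomial.algebraMap_eq, Algebra.algebraMap_eq_smul_one]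
  | add p q hp hq => simp [hp, hq]
  | mul_X p i hp =>
    rw [Subsingleton.elim i 0, map_mul, map_mul, mul_apply_eq_comp, hp, hU,
      mul_apply_eq_comp]

end HilbertModule

/-! ### The main theorem -/

theorem theorem3 {m : ℕ} (hm : 1 ≤ m)
    {E : Type*} [NormedAddCommGroup E] [InnerProductSpace ℂ E]
    {R : Type*} [NormedAddCommGroup R] [InnerProductSpace ℂ R] [CompleteSpace R]
    [RKHS ℂ R (Metric.ball (0 : EuclideanSpace ℂ (Fin m)) 1) E]
    (ρ : HilbertModule m R) (hρ : ρ.IsQuasiFree)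
    (hE : Module.finrank ℂ E = 1)
    (hsub : ∀ (S : Submodule ℂ R) (hS : ρ.IsSubmodule S), S ≠ ⊥ →
      (ρ.restrict S hS).IsometricallyIsomorphic ρ) :
    ∃ h : m = 1,
      (h ▸ ρ : HilbertModule 1 R).IsometricallyIsomorphic hardyModule ∧
      ∃ (φ : ℂ → ℂ) (g : CircleLinfty) (V : R ≃ₗᵢ[ℂ] hardy),
        IsConformalSelfMap φ ∧ IsBoundaryFunction φ g ∧
        ∀ f : R, V ((h ▸ ρ : HilbertModule 1 R) (MvPolynomial.X 0) f) = toeplitz g (V f) := by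
  obtain ⟨ev, one, hinj, hhol, hone, hact, hdense⟩ := hρ.exists_scalar_eval hE
  obtain ⟨W, hW, hker⟩ := HilbertModule.exists_isometric_multiplier hm ev one hone hact hdense hsub
  have hball : Metric.ball (0 : EuclideanSpace ℂ (Fin m)) 1 ∈ 𝓝 0 := Metric.ball_mem_nhds 0 one_pos
  have hm1 : m = 1 := by
    refine le_antisymm ?_ hm
    refine HilbertModule.dimension_le_one_of_forall_coordinate_eq_mul
      ((hhol (W one)).differentiableAt hball) ((hker _).2 ⟨one, rfl⟩) fun i => ?_
    obtain ⟨g, hg⟩ := (hker (ρ (MvPolynomial.X i) one)).1 (by rw [hact 0 (by simp)]; simp)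
    refine ⟨fun z => ev z g, (hhol g).differentiableAt hball, ?_⟩
    filter_upwards [hball] with z hz
    rw [← hW z hz, hg, hact z hz, hone z hz]
    simp
  subst hm1
  let ι : ℂ →L[ℂ] EuclideanSpace ℂ (Fin 1) :=
    (ContinuousLinearMap.id ℂ ℂ).smulRight (EuclideanSpace.single 0 1)
  have hι : ∀ z i, ι z i = z := fun z i => by simp [ι, Subsingleton.elim i 0]
  have hιn : ∀ z, ‖ι z‖ = ‖z‖ := fun z => by simp [ι, norm_smul]
  have hιb : ∀ z, z ∈ Metric.ball (0 : ℂ) 1 → ι z ∈ Metric.ball 0 1 := fun z hz => by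
    rw [mem_ball_zero_iff, hιn]
    simpa using hz
  have hιs : ∀ w : EuclideanSpace ℂ (Fin 1), ι (w 0) = w := fun w => by
    ext i
    rw [hι, Subsingleton.elim i 0]
  have hinj' : ∀ f, (∀ z ∈ Metric.ball (0 : ℂ) 1, ev (ι z) f = 0) → f = 0 := fun f hf =>
    hinj f fun w hw => by
      rw [← hιs w]
      refine hf _ ?_
      rw [mem_ball_zero_iff, ← hιn, hιs]
      simpa using hw
  set T : R →L[ℂ] R := ρ (MvPolynomial.X 0)
  have hT : ∀ z ∈ Metric.ball (0 : ℂ) 1, ∀ f, ev (ι z) (T f) = z * ev (ι z) f := fun z hz f => by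
    rw [hact _ (hιb z hz), MvPolynomial.eval_X, hι]
  obtain ⟨C, hC⟩ := hρ.bounded
  -- Every `z ^ n` is bounded by `1` on the disk, so the sup-norm bound gives power boundedness.
  have hTC : ∀ n : ℕ, ‖T ^ n‖ ≤ C := fun n => by
    have h := hC (MvPolynomial.X 0 ^ n) 1 fun z hz => by
      rw [map_pow, MvPolynomial.eval_X, norm_pow]
      refine pow_le_one₀ (norm_nonneg _) ?_
      rw [← hιn, hιs]
      simpa using (mem_ball_zero_iff.1 hz).le
    rwa [map_pow, mul_one] at h
  obtain ⟨c, hc, hWT⟩ := isometric_multiplier_eq_smul_coordinate (fun z => ev (ι z)) hinj'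
    (fun f => (hhol f).comp ι.differentiable.differentiableOn hιb) one
    (fun z hz => hone _ (hιb z hz)) T hT C hTC W (fun z hz => hW _ (hιb z hz))
    (by simpa only [map_zero] using hker)
  have hiso : ∀ f, ‖T f‖ = ‖f‖ := fun f => by
    rw [← W.norm_map f, hWT, norm_smul, hc, one_mul]
  obtain ⟨b, hb⟩ := exists_hilbertBasis_of_isometric_mul (fun z => ev (ι z)) hinj'
    (fun h => by
      have h1 := hone _ (hιb 0 (by simp))
      rw [show ev (ι 0) = 0 from h] at h1
      simp at h1) T hT hiso
    (fun f hf => by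
      obtain ⟨g, rfl⟩ := (hker f).1 (by simpa only [map_zero] using hf)
      exact ⟨c • g, by rw [map_smul, hWT]⟩)
  obtain ⟨b', hb'⟩ := exists_hilbertBasis_hardy
  obtain ⟨U, hU⟩ := b.exists_unitary_intertwining_of_shift b' T hardyShift hb fun n => by
    ext1
    rw [hb']
    change circleMul (fourierLp ∞ 1) (b' n : CircleL2) = _
    rw [hb', circleMul_fourierLp]
  -- The conformal map can be the identity, with boundary function `ζ`, and the same `U` serves as
  -- `V`.
  refine ⟨rfl, ⟨U, HilbertModule.intertwines_of_intertwines_X ρ hardyModule U fun f => ?_⟩,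
    id, fourierLp ∞ 1, U, ⟨differentiableOn_id, Set.bijOn_id _⟩, ?_, fun f => ?_⟩
  · rw [hardyModule_X]
    exact hU f
  · filter_upwards [coeFn_fourierLp (T := 1) ∞ 1] with t ht
    rw [ht, fourier_one]
    have h : Tendsto (fun r : ℝ => (r : ℂ) * (AddCircle.toCircle t : ℂ)) (𝓝 1)
        (𝓝 (((1 : ℝ) : ℂ) * (AddCircle.toCircle t : ℂ))) :=
      (Complex.continuous_ofReal.mul continuous_const).tendsto 1
    rw [Complex.ofReal_one, one_mul] at h
    exact h.mono_left nhdsWithin_le_nhds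
  · rw [toeplitz_fourierLp_one]
    exact hU f
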